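/- For positive integers $s_1,\dots,s_k$ and real $x_1,\dots,x_k$ let $$\mathrm{Li}^\star_{s_1,\dots,s_k}(x_1,\dots,x_k)=\sum_{n_1\ge n_2\ge\cdots\ge n_k\ge 1}\ \prod_{i=1}^k\frac{x_i^{n_i}}{n_i^{s_i}}$$ denote the multiple (star) polylogarithm. Write $\{1\}_r$ for $1$ repeated $r$ times, $\sqcup$ for concatenation of strings, $\delta_{i,j}$ for the Kronecker delta, and, for a string $\boldsymbol s=(s_1,\dots,s_k)$, $|\boldsymbol s|=s_1+\cdots+s_k$ and $\|\boldsymbol s\|=k$. Let $d\ge 1$, let $m_1,\dots,m_d,u_1,\dots,u_d$ be non-negative integers with $u_d\ge 1$, and put $$\boldsymbol s=\Bigl(\bigsqcup_{i=1}^d\{m_i+2,\{1\}_{u_i}\}\Bigr).$$ Let $(a,p)\in[-1,\tfrac13]\times[\tfrac12,\tfrac32]$ with $p\ne 1$ and $|a|\le\min\bigl(1,\tfrac2p-1\bigr)$. Then all the multiple polylogarithms below converge absolutely, and $$\mathrm{Li}^\star_{\{1\}_{|\boldsymbol s|}}\Bigl(\bigsqcup_{i=1}^{d}\bigl\{1-p,\{1\}_{m_i},\tfrac1{1-p},\{1\}_{u_i-\delta_{i,d}}\bigr\},\,1-p\Bigr)=-\mathrm{Li}^\star_{\boldsymbol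 s}\bigl(\{1\}_{\|\boldsymbol s\|-1},1-\tfrac1p\bigr),$$ $$\mathrm{Li}^\star_{\{1\}_{|\boldsymbol s|}}\Bigl(\bigsqcup_{i=1}^{d}\bigl\{1-p,\{1\}_{m_i},\tfrac1{1-p},\{1\}_{u_i-\delta_{i,d}}\bigr\},\,1-p+ap\Bigr)=\mathrm{Li}^\star_{\boldsymbol s}\bigl(\{1\}_{\|\boldsymbol s\|-1},a\bigr)-\mathrm{Li}^\star_{\boldsymbol s}\bigl(\{1\}_{\|\boldsymbol s\|-1},1-\tfrac1p\bigr).$$ -/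

import Mathlib

namespace StarPolylog

/-- The index set of a nested sum of depth `k`: all tuples `n₁ ≥ n₂ ≥ ⋯ ≥ n_k ≥ 1`. -/
def Idx (k : ℕ) : Set (Fin k → ℕ) :=
  {n | Antitone n ∧ ∀ i, 1 ≤ n i}

/-- The summand `∏ i, x_i ^ n_i / n_i ^ s_i` of the multiple polylogarithm with parameter string `s`
and argument string `x` of the same length. -/
noncomputable def term (s : List ℕ) (x : List ℝ) (h : s.length = x.length)
    (n : Fin s.length → ℕ) : ℝ :=
  ∏ i : Fin s.length, (x.get (Fin.cast h i)) ^ (n i) / (n i : ℝ) ^ (s.get i)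

/-- Convergence (unconditional, hence absolute) of the series defining the multiple polylogarithm
`Li⋆_s(x)`. -/
def Converges (s : List ℕ) (x : List ℝ) (h : s.length = x.length) : Prop :=
  Summable fun n : Idx s.length => term s x h n

/-- The multiple polylogarithm
`Li⋆_{s₁,…,s_d}(x₁,…,x_d) = ∑_{n₁ ≥ ⋯ ≥ n_d ≥ 1} ∏ i, x_i ^ n_i / n_i ^ s_i`. -/
noncomputable def Li (s : List ℕ) (x : List ℝ) (h : s.length = x.length) : ℝ :=
  ∑' n : Idx s.length, term s x h n

/-- The string `⊔_{i=1}^{d} {m_i + 2, {1}_{u_i}}`. -/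
def sString {d : ℕ} (m u : Fin d → ℕ) : List ℕ :=
  (List.ofFn fun i => (m i + 2) :: List.replicate (u i) 1).flatten

/-- The Kronecker delta `δ_{i,d}`, where the indices `1, …, d` are represented by `Fin d`. -/
def deltaLast {d : ℕ} (i : Fin d) : ℕ := if (i : ℕ) + 1 = d then 1 else 0

/-- The string `⊔_{i=1}^{d} {1 - p, {1}_{m_i}, 1 / (1 - p), {1}_{u_i - δ_{i,d}}}, y`. -/
noncomputable def longArgs {d : ℕ} (m u : Fin d → ℕ) (p y : ℝ) : List ℝ :=
  (List.ofFn fun i =>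
    [1 - p] ++ List.replicate (m i) 1 ++ [1 / (1 - p)]
      ++ List.replicate (u i - deltaLast i) 1).flatten ++ [y]

/-- The string `{1}_{r - 1}, y`. -/
def shortArgs (r : ℕ) (y : ℝ) : List ℝ := List.replicate (r - 1) 1 ++ [y]

theorem length_longArgs {d : ℕ} (m u : Fin d → ℕ) (hd : 1 ≤ d)
    (hu : ∀ i : Fin d, (i : ℕ) + 1 = d → 1 ≤ u i) (p y : ℝ) :
    (List.replicate (sString m u).sum 1).length = (longArgs m u p y).length := by
  obtain ⟨e, rfl⟩ : ∃ e, d = e + 1 := ⟨d - 1, by omega⟩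
  have h1 : 1 ≤ u (Fin.last e) := hu _ (by simp)
  have h2 : ∀ i : Fin e, deltaLast i.castSucc = 0 := fun i => by
    have := i.isLt
    simp only [deltaLast, Fin.val_castSucc]
    exact if_neg (by omega)
  have h3 : deltaLast (Fin.last e) = 1 := by simp [deltaLast]
  simp only [sString, longArgs, List.length_replicate, List.sum_flatten, List.length_append,
    List.length_flatten, List.map_ofFn, List.sum_ofFn, Function.comp_def, List.sum_cons,
    List.sum_replicate, List.length_cons, List.length_nil, Fin.sum_univ_castSucc, h2, h3,
    smul_eq_mul, mul_one, Nat.sub_zero]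
  have h4 : ∀ i : Fin e, 0 + 1 + m i.castSucc + (0 + 1) + u i.castSucc
      = m i.castSucc + 2 + u i.castSucc := fun i => by omega
  simp only [h4]
  omega

theorem length_shortArgs {d : ℕ} (m u : Fin d → ℕ) (hd : 1 ≤ d) (y : ℝ) :
    (sString m u).length = (shortArgs (sString m u).length y).length := by
  obtain ⟨e, rfl⟩ : ∃ e, d = e + 1 := ⟨d - 1, by omega⟩
  have : 1 ≤ (sString m u).length := by
    simp [sString, List.ofFn_succ]
  simp only [shortArgs, List.length_append, List.length_replicate, List.length_cons,
    List.length_nil]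
  omega

end StarPolylog

namespace StarPolylog

open Filter Topology

/-! Both kinds of polylogarithm are values of power series `gen c y`. Their coefficients come from
the constant sequence 1 by applying `tailOp 1` and `tailOp q` in an order given by one common word,
with q = 1 - p for the long argument strings and q = 0 for the short ones.

If G is the generating function of c, that of `tailOp x c` has derivative (G(x) - G(y)) / (x - y) at
y (`tsum_tailOp_mul_pow`). The map a ↦ q + p a sends 0 to q and 1 to 1, so it carries divided
differences based at 0 and 1 to those based at q and 1, up to a factor 1 / p that the chain rule
cancels. Induction on the word, starting from -log(1 - y), gives `gen_coeff_affine`: the two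
generating functions agree up to the additive constant `gen (coeff q w) q`. At a = 1 - 1/p the point
q + p a is 0, where `gen` vanishes; this determines the constant and is the first identity. A
general a then gives the second.

The series are matched with polylogarithms by `iter_args`, where powers of q cancel between
neighbouring equal letters, and by `coeff_zero_eq`, where `tailOp 0` only divides by n + 1 and so
raises an exponent. -/

/-- The tail operator `c ↦ (n ↦ ∑ k, x ^ k * c (n + k) / (n + k + 1))`. -/
noncomputable def tailOp (x : ℝ) (c : ℕ → ℝ) (n : ℕ) : ℝ :=
  ∑' k : ℕ, x ^ k * c (n + k) / ((n + k : ℕ) + 1)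

/-- The generating function `y ↦ ∑ n, c n * y ^ (n + 1) / (n + 1)`. -/
noncomputable def gen (c : ℕ → ℝ) (y : ℝ) : ℝ :=
  ∑' n : ℕ, c n * y ^ (n + 1) / (n + 1)

/-! ### Generating functions and the divided-difference identity -/

theorem gen_zero (c : ℕ → ℝ) : gen c 0 = 0 := by simp [gen]

theorem summable_one_div_succ_sq : Summable fun n : ℕ => 1 / ((n : ℝ) + 1) ^ 2 := by
  have h := (summable_nat_add_iff 1).2 (Real.summable_one_div_nat_pow.2 (one_lt_two))
  simpa using h

theorem abs_div_succ_le (n : ℕ) (t : ℝ) : |t / ((n : ℝ) + 1)| ≤ |t| := by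
  rw [abs_div, abs_of_pos (by positivity : (0 : ℝ) < n + 1)]
  exact div_le_self (abs_nonneg _) (by linarith [n.cast_nonneg (α := ℝ)])

theorem summable_gen {c : ℕ → ℝ} {M : ℝ} (hc : ∀ n, |c n| ≤ M) {y : ℝ} (hy : |y| < 1) :
    Summable fun n : ℕ => c n * y ^ (n + 1) / (n + 1) := by
  refine Summable.of_norm_bounded ((summable_geometric_of_abs_lt_one
    (r := |y|) (by simpa using hy)).mul_left M) fun n => ?_
  refine (abs_div_succ_le n _).trans ?_
  rw [abs_mul, abs_pow]
  refine mul_le_mul (hc n) (pow_le_pow_of_le_one (abs_nonneg y) hy.le n.le_succ)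
    (by positivity) ((abs_nonneg _).trans (hc n))

theorem abs_gen_term_le {c : ℕ → ℝ} {M : ℝ} (hc : ∀ n : ℕ, |c n| ≤ M / (n + 1)) {y : ℝ}
    (hy : |y| ≤ 1) (n : ℕ) :
    |c n * y ^ (n + 1) / (n + 1)| ≤ M * (1 / ((n : ℝ) + 1) ^ 2) := by
  have h0 : (0 : ℝ) < n + 1 := by positivity
  rw [abs_div, abs_mul, abs_pow, abs_of_pos h0, div_le_iff₀ h0]
  calc |c n| * |y| ^ (n + 1) ≤ |c n| * 1 :=
        mul_le_mul_of_nonneg_left (pow_le_one₀ (abs_nonneg y) hy) (abs_nonneg _)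
    _ ≤ M / (n + 1) := by rw [mul_one]; exact hc n
    _ = _ := by field_simp

theorem summable_gen_of_decay {c : ℕ → ℝ} {M : ℝ} (hc : ∀ n : ℕ, |c n| ≤ M / (n + 1)) {y : ℝ}
    (hy : |y| ≤ 1) : Summable fun n : ℕ => c n * y ^ (n + 1) / (n + 1) :=
  Summable.of_norm_bounded (summable_one_div_succ_sq.mul_left M) (abs_gen_term_le hc hy)

theorem continuousOn_gen {c : ℕ → ℝ} {M : ℝ} (hc : ∀ n : ℕ, |c n| ≤ M / (n + 1)) :
    ContinuousOn (gen c) {y | |y| ≤ 1} := by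
  refine continuousOn_tsum (fun n => by fun_prop) (summable_one_div_succ_sq.mul_left M) ?_
  intro n y hy
  exact abs_gen_term_le hc hy n

theorem hasDerivAt_gen {c : ℕ → ℝ} {M : ℝ} (hc : ∀ n, |c n| ≤ M) {y : ℝ} (hy : |y| < 1) :
    HasDerivAt (gen c) (∑' n, c n * y ^ n) y := by
  obtain ⟨r, hyr, hr⟩ := exists_between hy
  have hr0 : 0 ≤ r := (abs_nonneg y).trans hyr.le
  have hu : Summable fun n : ℕ => M * r ^ n :=
    (summable_geometric_of_lt_one hr0 hr).mul_left M
  refine hasDerivAt_tsum_of_isPreconnected (g := fun n y => c n * y ^ (n + 1) / ((n : ℝ) + 1))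
    (g' := fun n y => c n * y ^ n) (t := Set.Ioo (-r) r) (y₀ := 0)
    hu isOpen_Ioo isPreconnected_Ioo ?_ ?_ ?_ ?_ ?_
  · intro n z _
    have h := ((hasDerivAt_pow (n + 1) z).const_mul (c n)).div_const ((n : ℝ) + 1)
    refine h.congr_deriv ?_
    have : (n : ℝ) + 1 ≠ 0 := by positivity
    push_cast
    field_simp
  · intro n z hz
    rw [Real.norm_eq_abs, abs_mul, abs_pow]
    exact mul_le_mul (hc n) (pow_le_pow_left₀ (abs_nonneg z) (abs_lt.2 hz).le n)
      (by positivity) ((abs_nonneg _).trans (hc n))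
  · exact ⟨by linarith [hr0.lt_of_ne (by rintro rfl; exact absurd hyr (not_lt.2 (abs_nonneg y)))],
      hr0.lt_of_ne (by rintro rfl; exact absurd hyr (not_lt.2 (abs_nonneg y)))⟩
  · simp
  · exact abs_lt.1 hyr

/-- Grouping the double series by N = n + k leaves the geometric sum of x ^ k * y ^ n, which is the
divided difference of t ^ (N + 1). The majorant `g` does not depend on n, which justifies the
rearrangement. -/
theorem tsum_tailOp_mul_pow {c : ℕ → ℝ} {x y : ℝ} {g : ℕ → ℝ} (hg : Summable g)
    (hcg : ∀ n k : ℕ, |x ^ k * c (n + k) / ((n + k : ℕ) + 1)| ≤ g k) (hy : |y| < 1) (hxy : x ≠ y)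
    (hx : Summable fun n : ℕ => c n * x ^ (n + 1) / (n + 1))
    (hy' : Summable fun n : ℕ => c n * y ^ (n + 1) / (n + 1)) :
    ∑' n, tailOp x c n * y ^ n = (gen c x - gen c y) / (x - y) := by
  set F : ℕ × ℕ → ℝ := fun t => x ^ t.2 * c (t.1 + t.2) / ((t.1 + t.2 : ℕ) + 1) * y ^ t.1 with hF
  have hsum : Summable F := by
    have h1 : Summable fun t : ℕ × ℕ => |y| ^ t.1 * g t.2 :=
      Summable.mul_of_nonneg (summable_geometric_of_abs_lt_one (by simpa using hy)) hg
        (fun n => by positivity) (fun k => (abs_nonneg _).trans (hcg 0 k))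
    refine Summable.of_norm_bounded h1 fun t => ?_
    rw [Real.norm_eq_abs, abs_mul, abs_pow, mul_comm]
    exact mul_le_mul_of_nonneg_left (hcg t.1 t.2) (by positivity)
  have e1 : ∑' n, tailOp x c n * y ^ n = ∑' t, F t := by
    rw [hsum.tsum_prod]
    refine tsum_congr fun n => ?_
    rw [tailOp, ← tsum_mul_right]
  have e2 : ∑' t, F t = ∑' N, ∑ t ∈ Finset.HasAntidiagonal.antidiagonal N, F t := by
    rw [← (Finset.HasAntidiagonal.sigmaAntidiagonalEquivProd (A := ℕ)).tsum_eq F]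
    have hs := (Finset.HasAntidiagonal.sigmaAntidiagonalEquivProd (A := ℕ)).summable_iff.2 hsum
    refine (hs.tsum_sigma' (fun N => (hasSum_fintype _).summable)).trans ?_
    refine tsum_congr fun N => ?_
    rw [tsum_fintype]
    exact Finset.sum_coe_sort (Finset.HasAntidiagonal.antidiagonal N) F
  rw [e1, e2, gen, gen, ← hx.tsum_sub hy', ← tsum_div_const]
  refine tsum_congr fun N => ?_
  have hxy' : x - y ≠ 0 := sub_ne_zero.2 hxy
  have hgs : ∑ t ∈ Finset.HasAntidiagonal.antidiagonal N, x ^ t.2 * y ^ t.1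
      = (x ^ (N + 1) - y ^ (N + 1)) / (x - y) := by
    rw [eq_div_iff hxy', Finset.Nat.sum_antidiagonal_eq_sum_range_succ_mk,
      ← (Commute.all x y).geom_sum₂_mul, ← Finset.sum_range_reflect]
    congr 1
    refine Finset.sum_congr rfl fun i hi => ?_
    have := Finset.mem_range.1 hi
    congr 2
    omega
  calc ∑ t ∈ Finset.HasAntidiagonal.antidiagonal N, F t
      = ∑ t ∈ Finset.HasAntidiagonal.antidiagonal N, c N / (N + 1) * (x ^ t.2 * y ^ t.1) := by
        refine Finset.sum_congr rfl fun t ht => ?_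
        rw [hF, ← Finset.HasAntidiagonal.mem_antidiagonal.1 ht]
        ring
    _ = _ := by
        rw [← Finset.mul_sum, hgs]
        ring

/-! ### Bounds for the tail operator -/

theorem abs_tailOp_term_le_geometric {c : ℕ → ℝ} {M : ℝ} (hc : ∀ n, |c n| ≤ M) (x : ℝ) (n k : ℕ) :
    |x ^ k * c (n + k) / ((n + k : ℕ) + 1)| ≤ M / (n + 1) * |x| ^ k := by
  have hM : 0 ≤ M := (abs_nonneg _).trans (hc 0)
  have h0 : (0 : ℝ) < n + 1 := by positivity
  have h1 : (0 : ℝ) < (n + k : ℕ) + 1 := by positivity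
  rw [abs_div, abs_mul, abs_pow, abs_of_pos h1]
  calc |x| ^ k * |c (n + k)| / ((n + k : ℕ) + 1) ≤ |x| ^ k * M / (n + 1) := by
        gcongr
        · exact hc _
        · omega
    _ = _ := by ring

theorem abs_tailOp_term_le_sq {c : ℕ → ℝ} {M : ℝ} (hc : ∀ n : ℕ, |c n| ≤ M / (n + 1)) (n k : ℕ) :
    |(1 : ℝ) ^ k * c (n + k) / ((n + k : ℕ) + 1)| ≤ M * (1 / (((n + k : ℕ) : ℝ) + 1) ^ 2) := by
  have h1 : (0 : ℝ) < (n + k : ℕ) + 1 := by positivity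
  rw [one_pow, one_mul, abs_div, abs_of_pos h1, div_le_iff₀ h1]
  refine (hc (n + k)).trans (le_of_eq ?_)
  field_simp

theorem nonneg_of_decay {c : ℕ → ℝ} {M : ℝ} (hc : ∀ n : ℕ, |c n| ≤ M / (n + 1)) : 0 ≤ M := by
  simpa using (abs_nonneg _).trans (hc 0)

theorem bounded_of_decay {c : ℕ → ℝ} {M : ℝ} (hc : ∀ n : ℕ, |c n| ≤ M / (n + 1)) (n : ℕ) :
    |c n| ≤ M :=
  (hc n).trans (div_le_self (nonneg_of_decay hc) (by linarith [n.cast_nonneg (α := ℝ)]))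

theorem decay_tailOp {c : ℕ → ℝ} {M : ℝ} (hc : ∀ n, |c n| ≤ M) {x : ℝ} (hx : |x| < 1) (n : ℕ) :
    |tailOp x c n| ≤ M / (1 - |x|) / (n + 1) := by
  have hs : HasSum (fun k => M / ((n : ℝ) + 1) * |x| ^ k) (M / (n + 1) * (1 - |x|)⁻¹) :=
    (hasSum_geometric_of_lt_one (abs_nonneg x) hx).mul_left _
  have h : ‖tailOp x c n‖ ≤ _ := tsum_of_norm_bounded hs (abs_tailOp_term_le_geometric hc x n)
  rw [Real.norm_eq_abs] at h
  refine h.trans (le_of_eq ?_)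
  ring

theorem hasSum_telescope (n : ℕ) :
    HasSum (fun k : ℕ => 1 / (((n + k : ℕ) : ℝ) + 1) - 1 / (((n + (k + 1) : ℕ) : ℝ) + 1))
      (1 / ((n : ℝ) + 1)) := by
  have hanti : ∀ k : ℕ,
      0 ≤ 1 / (((n + k : ℕ) : ℝ) + 1) - 1 / (((n + (k + 1) : ℕ) : ℝ) + 1) := fun k => by
    rw [sub_nonneg]
    apply one_div_le_one_div_of_le (by positivity)
    gcongr
    omega
  rw [hasSum_iff_tendsto_nat_of_nonneg hanti]
  have hlim : Tendsto (fun N : ℕ => 1 / ((n : ℝ) + 1) - 1 / (((n + N : ℕ) : ℝ) + 1)) atTop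
      (𝓝 (1 / ((n : ℝ) + 1) - 0)) := by
    refine tendsto_const_nhds.sub ?_
    have h := tendsto_one_div_add_atTop_nhds_zero_nat (𝕜 := ℝ)
    exact h.comp (tendsto_atTop_mono (fun N => Nat.le_add_left N n) tendsto_id)
  rw [sub_zero] at hlim
  refine hlim.congr fun N => ?_
  rw [Finset.sum_range_sub' (fun k => 1 / (((n + k : ℕ) : ℝ) + 1))]
  simp

/-- Comparison with a telescoping series: 1/(t+1)² ≤ 2 (1/(t+1) - 1/(t+2)) for t ≥ 0. -/
theorem decay_tailOp_one {c : ℕ → ℝ} {M : ℝ} (hc : ∀ n : ℕ, |c n| ≤ M / (n + 1)) (n : ℕ) :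
    |tailOp 1 c n| ≤ 2 * M / (n + 1) := by
  have hM := nonneg_of_decay hc
  have h := tsum_of_norm_bounded ((hasSum_telescope n).mul_left (2 * M))
    (f := fun k : ℕ => (1 : ℝ) ^ k * c (n + k) / ((n + k : ℕ) + 1)) fun k => by
      refine (abs_tailOp_term_le_sq hc n k).trans ?_
      rw [mul_comm 2 M, mul_assoc]
      refine mul_le_mul_of_nonneg_left ?_ hM
      have h0 : (0 : ℝ) ≤ (n + k : ℕ) := by positivity
      rw [show ((n + (k + 1) : ℕ) : ℝ) = (n + k : ℕ) + 1 by push_cast; ring]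
      generalize ((n + k : ℕ) : ℝ) = t at h0
      rw [div_sub_div _ _ (by positivity) (by positivity), mul_div_assoc',
        div_le_div_iff₀ (by positivity) (by positivity)]
      nlinarith
  rw [Real.norm_eq_abs] at h
  refine h.trans (le_of_eq ?_)
  ring

theorem tsum_tailOp_mul_pow_of_bounded {c : ℕ → ℝ} {M : ℝ} (hc : ∀ n, |c n| ≤ M) {x y : ℝ}
    (hx : |x| < 1) (hy : |y| < 1) (hxy : x ≠ y) :
    ∑' n, tailOp x c n * y ^ n = (gen c x - gen c y) / (x - y) := by
  have hM : 0 ≤ M := (abs_nonneg _).trans (hc 0)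
  refine tsum_tailOp_mul_pow ((summable_geometric_of_lt_one (abs_nonneg x) hx).mul_left M)
    (fun n k => (abs_tailOp_term_le_geometric hc x n k).trans ?_) hy hxy
    (summable_gen hc hx) (summable_gen hc hy)
  exact mul_le_mul_of_nonneg_right (div_le_self hM (by linarith [n.cast_nonneg (α := ℝ)]))
    (by positivity)

theorem tsum_tailOp_one_mul_pow {c : ℕ → ℝ} {M : ℝ} (hc : ∀ n : ℕ, |c n| ≤ M / (n + 1)) {y : ℝ}
    (hy : |y| < 1) :
    ∑' n, tailOp 1 c n * y ^ n = (gen c 1 - gen c y) / (1 - y) := by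
  have hM := nonneg_of_decay hc
  refine tsum_tailOp_mul_pow (summable_one_div_succ_sq.mul_left M)
    (fun n k => (abs_tailOp_term_le_sq hc n k).trans ?_) hy (abs_lt.1 hy).2.ne'
    (summable_gen_of_decay hc (by simp)) (summable_gen_of_decay hc hy.le)
  gcongr
  omega

/-! ### Affine transformation of generating functions -/

/-- The coefficients attached to a word (its last letter first): `true` acts by `tailOp 1` and
`false` by `tailOp q`. -/
noncomputable def coeff (q : ℝ) : List Bool → ℕ → ℝ
  | [] => fun _ => 1
  | true :: w => tailOp 1 (coeff q w)
  | false :: w => tailOp q (coeff q w)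

/-- The words whose first letter is `false`, together with the empty word. -/
def Admissible : List Bool → Prop
  | [] => True
  | true :: w => Admissible w ∧ w ≠ []
  | false :: w => Admissible w

/-- The innermost letter must be `false`: `tailOp 1` of the constant 1 is a harmonic tail, whereas
`tailOp q` converges geometrically and gains a factor 1/(n+1). Both operators then preserve this
decay. -/
theorem exists_decay_coeff {q : ℝ} (hq : |q| < 1) : ∀ w : List Bool, Admissible w → w ≠ [] →
    ∃ M, ∀ n : ℕ, |coeff q w n| ≤ M / (n + 1)
  | [], _, h => absurd rfl h
  | true :: w, hw, _ => by
    obtain ⟨M, hM⟩ := exists_decay_coeff hq w hw.1 hw.2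
    exact ⟨_, decay_tailOp_one hM⟩
  | [false], _, _ => ⟨_, decay_tailOp (c := fun _ => 1) (M := 1) (by simp) hq⟩
  | false :: b :: w, hw, _ => by
    obtain ⟨M, hM⟩ := exists_decay_coeff hq (b :: w) hw (by simp)
    exact ⟨_, decay_tailOp (bounded_of_decay hM) hq⟩

theorem exists_bound_coeff {q : ℝ} (hq : |q| < 1) (w : List Bool) (hw : Admissible w) :
    ∃ M, ∀ n : ℕ, |coeff q w n| ≤ M := by
  by_cases h : w = []
  · subst h
    exact ⟨1, by simp [coeff]⟩
  · obtain ⟨M, hM⟩ := exists_decay_coeff hq w hw h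
    exact ⟨M, bounded_of_decay hM⟩

/-- Mean value theorem on the segment between 0 and a, which stays in the region by convexity. The
point 0 is only an endpoint, so no derivative is needed there; this matters because the divided
difference based at q is undefined at y = q. -/
theorem eq_of_hasDerivAt_zero {F : ℝ → ℝ} {p q : ℝ} (hp : 0 < p) (hq : |q| < 1)
    (hc : ContinuousOn F {a | |a| ≤ 1 ∧ |q + p * a| ≤ 1})
    (hd : ∀ t, t ≠ 0 → |t| < 1 → |q + p * t| < 1 → HasDerivAt F 0 t)
    {a : ℝ} (ha : |a| ≤ 1) (hy : |q + p * a| ≤ 1) : F a = F 0 := by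
  rw [abs_le] at ha hy
  rw [abs_lt] at hq
  rcases lt_trichotomy a 0 with h | rfl | h
  · have hsub : ∀ t ∈ Set.Icc a 0, p * a ≤ p * t ∧ p * t ≤ 0 := fun t ht =>
      ⟨mul_le_mul_of_nonneg_left ht.1 hp.le, by nlinarith [ht.2]⟩
    obtain ⟨t, _, h2⟩ := exists_hasDerivAt_eq_slope F (fun _ => 0) h
      (hc.mono fun t ht => by
        have := hsub t ht
        exact ⟨abs_le.2 ⟨by linarith [ht.1], by linarith [ht.2]⟩,
          abs_le.2 ⟨by linarith, by linarith⟩⟩)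
      (fun t ht => by
        have h3 : p * a < p * t := mul_lt_mul_of_pos_left ht.1 hp
        have h4 : p * t < 0 := mul_neg_of_pos_of_neg hp ht.2
        exact hd t ht.2.ne (abs_lt.2 ⟨by linarith [ht.1], by linarith [ht.2]⟩)
          (abs_lt.2 ⟨by linarith, by linarith⟩))
    rw [eq_comm, div_eq_zero_iff] at h2
    rcases h2 with h2 | h2 <;> linarith
  · rfl
  · have hsub : ∀ t ∈ Set.Icc 0 a, p * t ≤ p * a ∧ 0 ≤ p * t := fun t ht =>
      ⟨mul_le_mul_of_nonneg_left ht.2 hp.le, mul_nonneg hp.le ht.1⟩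
    obtain ⟨t, _, h2⟩ := exists_hasDerivAt_eq_slope F (fun _ => 0) h
      (hc.mono fun t ht => by
        have := hsub t ht
        exact ⟨abs_le.2 ⟨by linarith [ht.1], by linarith [ht.2]⟩,
          abs_le.2 ⟨by linarith, by linarith⟩⟩)
      (fun t ht => by
        have h3 : p * t < p * a := mul_lt_mul_of_pos_left ht.2 hp
        have h4 : 0 < p * t := mul_pos hp ht.1
        exact hd t ht.1.ne' (abs_lt.2 ⟨by linarith [ht.1], by linarith [ht.2]⟩)
          (abs_lt.2 ⟨by linarith, by linarith⟩))
    rw [eq_comm, div_eq_zero_iff] at h2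
    rcases h2 with h2 | h2 <;> linarith

theorem gen_one {y : ℝ} (hy : |y| < 1) : gen (fun _ => 1) y = -Real.log (1 - y) := by
  rw [← (Real.hasSum_pow_div_log_of_abs_lt_one hy).tsum_eq, gen]
  simp

/-- It suffices to compare derivatives away from `0`. -/
theorem gen_affine_of_deriv {c b : ℕ → ℝ} {M N : ℝ} (hc : ∀ n : ℕ, |c n| ≤ M / (n + 1))
    (hb : ∀ n : ℕ, |b n| ≤ N / (n + 1)) {p q : ℝ} (hp : 0 < p) (hq : |q| < 1)
    (hd : ∀ t, t ≠ 0 → |t| < 1 → |q + p * t| < 1 →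
      (∑' n, c n * (q + p * t) ^ n) * p = ∑' n, b n * t ^ n)
    {a : ℝ} (ha : |a| ≤ 1) (hy : |q + p * a| ≤ 1) :
    gen c (q + p * a) = gen b a + gen c q := by
  have h := eq_of_hasDerivAt_zero (F := fun a => gen c (q + p * a) - gen b a) hp hq ?_ ?_ ha hy
  · simp only [mul_zero, add_zero, gen_zero, sub_zero] at h
    linarith
  · refine ContinuousOn.sub ?_ ((continuousOn_gen hb).mono fun t ht => ht.1)
    exact (continuousOn_gen hc).comp (by fun_prop) fun t ht => ht.2
  · intro t ht0 ht hyt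
    have h1 : HasDerivAt (fun t => q + p * t) p t := by
      simpa using ((hasDerivAt_id t).const_mul p).const_add q
    have h2 := (hasDerivAt_gen (bounded_of_decay hc) hyt).comp t h1
    refine (h2.sub (hasDerivAt_gen (bounded_of_decay hb) ht)).congr_deriv ?_
    rw [hd t ht0 ht hyt, sub_self]

/-- The empty word needs strict bounds because its generating function is a logarithm, singular at
1. Nonempty admissible words have generating functions continuous up to the boundary. -/
theorem gen_coeff_affine {p q : ℝ} (hp : 0 < p) (hpq : q = 1 - p) (hq : |q| < 1) :
    ∀ w : List Bool, Admissible w → ∀ a : ℝ, |a| ≤ 1 → |q + p * a| ≤ 1 →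
      (w = [] → |a| < 1 ∧ |q + p * a| < 1) →
      gen (coeff q w) (q + p * a) = gen (coeff 0 w) a + gen (coeff q w) q
  | [], _, a, _, _, h => by
    obtain ⟨ha, hy⟩ := h rfl
    have h1 : 1 - a ≠ 0 := by linarith [(abs_lt.1 ha).2]
    simp only [coeff]
    rw [gen_one hy, gen_one ha, gen_one hq, hpq,
      show 1 - (1 - p + p * a) = (1 - a) * (1 - (1 - p)) by ring,
      Real.log_mul h1 (by linarith)]
    ring
  | true :: w, hw, a, ha, hy, _ => by
    obtain ⟨M, hM⟩ := exists_decay_coeff hq w hw.1 hw.2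
    obtain ⟨N, hN⟩ := exists_decay_coeff (q := 0) (by simp) w hw.1 hw.2
    refine gen_affine_of_deriv (decay_tailOp_one hM) (decay_tailOp_one hN) hp hq ?_ ha hy
    intro t _ ht hyt
    have ih := gen_coeff_affine hp hpq hq w hw.1
    have i1 := ih t ht.le hyt.le fun h => absurd h hw.2
    -- The base point 1 of `tailOp 1` is the image of a = 1, a boundary value available since `w` is
    -- nonempty. The additive constant cancels between `i1` and `i2`.
    have i2 := ih 1 (by simp) (by simp [hpq]) fun h => absurd h hw.2
    rw [show q + p * 1 = 1 by linarith] at i2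
    have h1 : 1 - t ≠ 0 := by linarith [(abs_lt.1 ht).2]
    rw [tsum_tailOp_one_mul_pow hM hyt, tsum_tailOp_one_mul_pow hN ht, i1, i2,
      show 1 - (q + p * t) = p * (1 - t) by rw [hpq]; ring]
    field_simp
    ring
  | false :: w, hw, a, ha, hy, _ => by
    obtain ⟨M, hM⟩ := exists_bound_coeff hq w hw
    obtain ⟨N, hN⟩ := exists_bound_coeff (q := 0) (by simp) w hw
    refine gen_affine_of_deriv (decay_tailOp hM hq) (decay_tailOp hN (by simp)) hp hq ?_ ha hy
    intro t ht0 ht hyt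
    -- Here `w` may be empty, but only interior points and the base point a = 0 are used.
    have i1 := gen_coeff_affine hp hpq hq w hw t ht.le hyt.le fun _ => ⟨ht, hyt⟩
    have hne : q ≠ q + p * t := by
      have := mul_ne_zero hp.ne' ht0
      intro h
      exact this (by linarith)
    rw [tsum_tailOp_mul_pow_of_bounded hM hq hyt hne,
      tsum_tailOp_mul_pow_of_bounded hN (by simp) ht ht0.symm, i1, gen_zero,
      show q - (q + p * t) = -(p * t) by ring]
    field_simp
    ring

/-! ### Nested sums as iterated series -/

/-- The iterated series `∑ φ₁(n₁) ⋯ φ_k(n_k)` over `n₁ ≥ ⋯ ≥ n_k ≥ n + 1`, for the list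
`[φ_k, …, φ₁]`. -/
noncomputable def iter : List (ℕ → ℝ) → ℕ → ℝ
  | [], _ => 1
  | φ :: l, n => ∑' j : ℕ, φ (n + j + 1) * iter l (n + j)

/-- All series occurring in `iter l` are summable. -/
def IterSummable : List (ℕ → ℝ) → Prop
  | [] => True
  | φ :: l => IterSummable l ∧ ∀ n, Summable fun j : ℕ => φ (n + j + 1) * iter l (n + j)

/-- All tuples `n₁ ≥ ⋯ ≥ n_k ≥ n + 1`. -/
def tailIdx (n k : ℕ) : Set (Fin k → ℕ) :=
  {v | Antitone v ∧ ∀ i, n + 1 ≤ v i}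

theorem snoc_mem_tailIdx {n k j : ℕ} {v : Fin k → ℕ} (hv : v ∈ tailIdx (n + j) k) :
    (Fin.snoc v (n + j + 1) : Fin (k + 1) → ℕ) ∈ tailIdx n (k + 1) := by
  refine ⟨fun a b hab => ?_, fun i => ?_⟩
  · induction b using Fin.lastCases with
    | last =>
      induction a using Fin.lastCases with
      | last => exact le_rfl
      | cast a => simpa using hv.2 a
    | cast b =>
      induction a using Fin.lastCases with
      | last => exact absurd hab (not_le.2 (Fin.castSucc_lt_last b))
      | cast a => simpa using hv.1 (by simpa using hab)
  · induction i using Fin.lastCases with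
    | last => simp
    | cast i =>
      have := hv.2 i
      simp only [Fin.snoc_castSucc]
      omega

/-- Splitting off the smallest entry of a tuple. -/
noncomputable def tailIdxEquiv (n k : ℕ) :
    (Σ j : ℕ, tailIdx (n + j) k) ≃ tailIdx n (k + 1) :=
  Equiv.ofBijective (fun t => ⟨Fin.snoc t.2.1 (n + t.1 + 1), snoc_mem_tailIdx t.2.2⟩) <| by
    constructor
    · rintro ⟨j, v, hv⟩ ⟨j', v', hv'⟩ h
      have h1 : (Fin.snoc v (n + j + 1) : Fin (k + 1) → ℕ) = Fin.snoc v' (n + j' + 1) :=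
        Subtype.ext_iff.1 h
      obtain ⟨h2, h3⟩ := Fin.snoc_inj.1 h1
      obtain rfl : j = j' := by omega
      subst h2
      rfl
    · rintro ⟨v, hv⟩
      have hl := hv.2 (Fin.last k)
      have e : n + (v (Fin.last k) - n - 1) + 1 = v (Fin.last k) := by omega
      refine ⟨⟨v (Fin.last k) - n - 1, Fin.init v, ?_, fun i => ?_⟩, ?_⟩
      · exact fun a b hab => hv.1 (by simpa using hab)
      · rw [e]
        exact hv.1 (Fin.le_last _)
      · apply Subtype.ext
        simp only [e, Fin.snoc_init_self]

theorem tailIdxEquiv_apply {n k : ℕ} (f : Fin (k + 1) → ℕ → ℝ) (t : Σ j : ℕ, tailIdx (n + j) k) :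
    ∏ i, f i ((tailIdxEquiv n k t).1 i)
      = f (Fin.last k) (n + t.1 + 1) * ∏ i : Fin k, f i.castSucc (t.2.1 i) := by
  rw [Fin.prod_univ_castSucc, mul_comm]
  have h : (tailIdxEquiv n k t).1 = Fin.snoc t.2.1 (n + t.1 + 1) := rfl
  simp [h]

theorem reverse_ofFn_succ {α : Type*} {k : ℕ} (f : Fin (k + 1) → α) :
    (List.ofFn f).reverse = f (Fin.last k) :: (List.ofFn fun i : Fin k => f i.castSucc).reverse := by
  rw [List.ofFn_succ', List.concat_eq_append, List.reverse_append]
  rfl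

theorem hasSum_tailIdx_zero (n : ℕ) (f : Fin 0 → ℕ → ℝ) :
    HasSum (fun v : tailIdx n 0 => ∏ i, f i (v.1 i)) 1 := by
  have : Unique (tailIdx n 0) :=
    { default := ⟨Fin.elim0, fun a => a.elim0, fun a => a.elim0⟩
      uniq := fun v => Subtype.ext (Subsingleton.elim _ _) }
  simp

/-- For nonnegative terms iterated summability already gives joint summability. Applied to absolute
values, this supplies the absolute convergence that the signed case needs. -/
theorem hasSum_tailIdx_of_nonneg : ∀ {k : ℕ} (f : Fin k → ℕ → ℝ), (∀ i m, 0 ≤ f i m) →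
    IterSummable (List.ofFn f).reverse → ∀ n,
    HasSum (fun v : tailIdx n k => ∏ i, f i (v.1 i)) (iter (List.ofFn f).reverse n)
  | 0, f, _, _, n => hasSum_tailIdx_zero n f
  | k + 1, f, hf, hs, n => by
    rw [reverse_ofFn_succ] at hs ⊢
    have ih := hasSum_tailIdx_of_nonneg (fun i : Fin k => f i.castSucc) (fun i => hf _) hs.1
    have inner := fun j : ℕ => (ih (n + j)).mul_left (f (Fin.last k) (n + j + 1))
    rw [← (tailIdxEquiv n k).hasSum_iff]
    simp only [Function.comp_def, tailIdxEquiv_apply]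
    refine (hs.2 n).hasSum.sigma_of_hasSum inner ?_
    rw [summable_sigma_of_nonneg]
    · refine ⟨fun j => (inner j).summable, ?_⟩
      simp only [fun j => (inner j).tsum_eq]
      exact hs.2 n
    · exact fun t => mul_nonneg (hf _ _) (Finset.prod_nonneg fun i _ => hf _ _)

theorem summable_tailIdx {k : ℕ} (f : Fin k → ℕ → ℝ)
    (hs : IterSummable (List.ofFn fun i m => |f i m|).reverse) (n : ℕ) :
    Summable fun v : tailIdx n k => ∏ i, f i (v.1 i) := by
  have h := (hasSum_tailIdx_of_nonneg (fun i m => |f i m|) (fun _ _ => abs_nonneg _) hs n).summable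
  refine Summable.of_norm (h.congr fun v => ?_)
  rw [Real.norm_eq_abs, Finset.abs_prod]

theorem hasSum_tailIdx : ∀ {k : ℕ} (f : Fin k → ℕ → ℝ),
    IterSummable (List.ofFn fun i m => |f i m|).reverse → ∀ n,
    HasSum (fun v : tailIdx n k => ∏ i, f i (v.1 i)) (iter (List.ofFn f).reverse n)
  | 0, f, _, n => hasSum_tailIdx_zero n f
  | k + 1, f, hs, n => by
    have hsum := summable_tailIdx f hs n
    rw [reverse_ofFn_succ] at hs ⊢
    have ih := hasSum_tailIdx (fun i : Fin k => f i.castSucc) hs.1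
    have inner := fun j : ℕ => (ih (n + j)).mul_left (f (Fin.last k) (n + j + 1))
    rw [← (tailIdxEquiv n k).summable_iff] at hsum
    rw [← (tailIdxEquiv n k).hasSum_iff]
    simp only [Function.comp_def, tailIdxEquiv_apply] at hsum ⊢
    have h := hsum.hasSum.sigma inner
    rw [iter, h.tsum_eq]
    exact hsum.hasSum

/-- The weight `n ↦ x ^ n / n ^ s`. -/
noncomputable def weight (s : ℕ) (x : ℝ) (n : ℕ) : ℝ := x ^ n / (n : ℝ) ^ s

theorem abs_weight (s : ℕ) (x : ℝ) (n : ℕ) : |weight s x n| = weight s |x| n := by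
  simp [weight, abs_div, abs_pow]

theorem ofFn_weight (s : List ℕ) (x : List ℝ) (h : s.length = x.length) :
    (List.ofFn fun i : Fin s.length => weight (s.get i) (x.get (Fin.cast h i)))
      = List.zipWith weight s x := by
  apply List.ext_get
  · simp [h]
  · intro i h1 h2
    simp

theorem converges_and_Li_eq (s : List ℕ) (x : List ℝ) (h : s.length = x.length)
    (hs : IterSummable (List.zipWith weight s.reverse (x.reverse.map abs))) :
    Converges s x h ∧ Li s x h = iter (List.zipWith weight s.reverse x.reverse) 0 := by
  set f : Fin s.length → ℕ → ℝ := fun i => weight (s.get i) (x.get (Fin.cast h i)) with hf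
  have e : (List.ofFn f).reverse = List.zipWith weight s.reverse x.reverse := by
    rw [hf, ofFn_weight, List.reverse_zipWith h]
  have e' : (List.ofFn fun i m => |f i m|).reverse
      = List.zipWith weight s.reverse (x.reverse.map abs) := by
    have h' : s.length = (x.map abs).length := by simpa using h
    rw [List.map_reverse, ← List.reverse_zipWith h', ← ofFn_weight s _ h']
    congr 2
    funext i m
    rw [hf]
    simp [abs_weight]
  rw [← e'] at hs
  have key := hasSum_tailIdx f hs 0
  rw [e] at key
  exact ⟨key.summable, key.tsum_eq⟩

/-! ### Words and argument strings -/

theorem summable_tailOp_one {c : ℕ → ℝ} {M : ℝ} (hc : ∀ n : ℕ, |c n| ≤ M / (n + 1)) (n : ℕ) :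
    Summable fun k : ℕ => (1 : ℝ) ^ k * c (n + k) / ((n + k : ℕ) + 1) := by
  refine Summable.of_norm_bounded ?_ (abs_tailOp_term_le_sq hc n)
  refine Summable.mul_left M ?_
  have h := (summable_nat_add_iff n).2 summable_one_div_succ_sq
  simpa only [add_comm] using h

theorem summable_tailOp {c : ℕ → ℝ} {M : ℝ} (hc : ∀ n, |c n| ≤ M) {x : ℝ} (hx : |x| < 1) (n : ℕ) :
    Summable fun k : ℕ => x ^ k * c (n + k) / ((n + k : ℕ) + 1) :=
  Summable.of_norm_bounded ((summable_geometric_of_lt_one (abs_nonneg x) hx).mul_left _)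
    (abs_tailOp_term_le_geometric hc x n)

theorem tailOp_zero (c : ℕ → ℝ) (n : ℕ) : tailOp 0 c n = c n / (n + 1) := by
  rw [tailOp, tsum_eq_single 0 fun k hk => by simp [hk]]
  simp

/-- Whether the head of a word is `false`. -/
def headFalse : List Bool → Bool
  | false :: _ => true
  | _ => false

/-- The arguments, last one first, of the polylogarithm with tails `coeff q w`. -/
noncomputable def args (q : ℝ) : List Bool → List ℝ
  | [] => []
  | true :: w => (if headFalse w then q⁻¹ else 1) :: args q w
  | false :: w => (if headFalse w then 1 else q) :: args q w

/-- Absolute convergence for q thus reduces to the same argument string for |q|. -/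
theorem map_abs_args (q : ℝ) : ∀ w, (args q w).map abs = args |q| w
  | [] => rfl
  | true :: w => by
    simp only [args, List.map_cons, map_abs_args q w]
    split_ifs <;> simp
  | false :: w => by
    simp only [args, List.map_cons, map_abs_args q w]
    split_ifs <;> simp

theorem args_term_true {q : ℝ} (hq : q ≠ 0) (w : List Bool) (n j : ℕ) :
    weight 1 (if headFalse w then q⁻¹ else 1) (n + j + 1)
        * ((if headFalse w then q ^ (n + j + 1) else 1) * coeff q w (n + j))
      = 1 ^ j * coeff q w (n + j) / ((n + j : ℕ) + 1) := by
  simp only [weight]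
  split_ifs
  · have : q ^ (n + j + 1) ≠ 0 := pow_ne_zero _ hq
    rw [inv_pow, pow_one, one_pow, one_mul]
    push_cast
    field_simp
  · push_cast
    simp
    ring

theorem args_term_false {q : ℝ} (w : List Bool) (n j : ℕ) :
    weight 1 (if headFalse w then 1 else q) (n + j + 1)
        * ((if headFalse w then q ^ (n + j + 1) else 1) * coeff q w (n + j))
      = q ^ (n + 1) * (q ^ j * coeff q w (n + j) / ((n + j : ℕ) + 1)) := by
  simp only [weight]
  split_ifs <;> push_cast <;> ring

/-- In `tailOp q`, write q ^ j as q ^ (n+j+1) / q ^ (n+1): the numerator belongs to the current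
index, the denominator to the next smaller one. Equal neighbours `false` cancel to argument 1, a
change of letter leaves q or q⁻¹, and a `false` at the head leaves q ^ (n+1) uncompensated. -/
theorem iter_args {q : ℝ} (hq : q ≠ 0) : ∀ (w : List Bool) (n : ℕ),
    iter ((args q w).map (weight 1)) n = (if headFalse w then q ^ (n + 1) else 1) * coeff q w n
  | [], n => by simp [args, iter, headFalse, coeff]
  | true :: w, n => by
    rw [args, List.map_cons, iter]
    simp only [iter_args hq w, args_term_true hq]
    rw [coeff, tailOp, headFalse.eq_def, if_neg (by simp), one_mul]
  | false :: w, n => by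
    rw [args, List.map_cons, iter]
    simp only [iter_args hq w, args_term_false]
    rw [coeff, tailOp, headFalse.eq_def, if_pos (by simp), tsum_mul_left]

theorem iterSummable_args {q : ℝ} (hq : q ≠ 0) (hq1 : |q| < 1) : ∀ w : List Bool, Admissible w →
    IterSummable ((args q w).map (weight 1))
  | [], _ => trivial
  | true :: w, hw => by
    obtain ⟨M, hM⟩ := exists_decay_coeff hq1 w hw.1 hw.2
    refine ⟨iterSummable_args hq hq1 w hw.1, fun n => ?_⟩
    simp only [iter_args hq, args_term_true hq]
    exact summable_tailOp_one hM n
  | false :: w, hw => by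
    obtain ⟨M, hM⟩ := exists_bound_coeff hq1 w hw
    refine ⟨iterSummable_args hq hq1 w hw, fun n => ?_⟩
    simp only [iter_args hq, args_term_false]
    exact (summable_tailOp hM hq1 n).mul_left _

/-- The number of letters `false` at the head of a word. -/
def lead : List Bool → ℕ
  | false :: w => lead w + 1
  | _ => 0

/-- The exponents, last one first, of the polylogarithm whose tails are given by `coeff 0 w`. -/
def exps : List Bool → List ℕ
  | [] => []
  | true :: w => (lead w + 1) :: exps w
  | false :: w => exps w

theorem exps_term (w : List Bool) (n j : ℕ)
    (h : coeff 0 w (n + j) = ((n + j : ℕ) + 1 : ℝ)⁻¹ ^ lead w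
      * iter ((exps w).map fun s => weight s 1) (n + j)) :
    weight (lead w + 1) 1 (n + j + 1) * iter ((exps w).map fun s => weight s 1) (n + j)
      = 1 ^ j * coeff 0 w (n + j) / ((n + j : ℕ) + 1) := by
  have h0 : ((n + j : ℕ) + 1 : ℝ) ≠ 0 := by positivity
  rw [h, weight, Nat.cast_succ, one_pow, one_pow, one_mul, pow_succ, inv_pow]
  have h1 := pow_ne_zero (lead w) h0
  field_simp

/-- Each leading `false` is a factor 1/(n+1) not yet under a summation sign; the next `true` sums
over it and absorbs it into its exponent. -/
theorem coeff_zero_eq : ∀ (w : List Bool) (n : ℕ),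
    coeff 0 w n = ((n : ℝ) + 1)⁻¹ ^ lead w * iter ((exps w).map fun s => weight s 1) n
  | [], n => by simp [coeff, lead, exps, iter]
  | true :: w, n => by
    simp only [coeff, tailOp, lead, exps, List.map_cons, iter, pow_zero, one_mul]
    exact tsum_congr fun j => by
      rw [exps_term w n j (coeff_zero_eq w (n + j)), one_pow, one_mul]
  | false :: w, n => by
    rw [coeff, tailOp_zero, coeff_zero_eq w n, lead, exps, pow_succ]
    ring

theorem iterSummable_exps : ∀ w : List Bool, Admissible w →
    IterSummable ((exps w).map fun s => weight s 1)
  | [], _ => trivial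
  | true :: w, hw => by
    obtain ⟨M, hM⟩ := exists_decay_coeff (q := 0) (by simp) w hw.1 hw.2
    refine ⟨iterSummable_exps w hw.1, fun n => ?_⟩
    simp only [fun j => exps_term w n j (coeff_zero_eq w (n + j))]
    exact summable_tailOp_one hM n
  | false :: w, hw => iterSummable_exps w hw

theorem weight_one_mul (y c : ℝ) (j : ℕ) :
    weight 1 y (0 + j + 1) * c = c * y ^ (j + 1) / (j + 1) := by
  simp only [weight, zero_add]
  push_cast
  ring

/-! ### Polylogarithms as values of generating functions -/

/-- Polylogarithms with all exponents `1` as generating functions of `coeff q w`. -/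
theorem converges_and_Li_eq_gen_long {q : ℝ} (hq : q ≠ 0) (hq1 : |q| < 1) {w : List Bool}
    (hw : Admissible w) (hne : w ≠ []) (hh : headFalse w = false) {y : ℝ} (hy : |y| ≤ 1)
    {k : ℕ} {x : List ℝ} (hx : x.reverse = y :: args q w)
    (h : (List.replicate k 1).length = x.length) :
    Converges (List.replicate k 1) x h ∧ Li (List.replicate k 1) x h = gen (coeff q w) y := by
  have hz : ∀ z : List ℝ, z.length = k →
      List.zipWith weight (List.replicate k 1).reverse z = z.map (weight 1) := fun z hz => by
    rw [List.reverse_replicate, ← hz]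
    clear hz
    induction z with
    | nil => rfl
    | cons a z ih => simp [List.replicate_succ, ih]
  have hk : k = x.length := by simpa using h
  have hq0 : |q| ≠ 0 := abs_ne_zero.2 hq
  have hq1' : |(|q|)| < 1 := by rwa [abs_abs]
  -- Decay for |q| instead of q, since summability is tested on absolute values.
  obtain ⟨M, hM⟩ := exists_decay_coeff hq1' w hw hne
  have key := converges_and_Li_eq (List.replicate k 1) x h ?_
  · refine ⟨key.1, key.2.trans ?_⟩
    rw [hz _ (by simp [hk]), hx, List.map_cons, iter, gen]
    refine tsum_congr fun j => ?_
    rw [iter_args hq, hh, weight_one_mul]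
    simp
  · rw [hz _ (by simp [hk]), hx, List.map_cons, map_abs_args, List.map_cons]
    refine ⟨iterSummable_args hq0 hq1' w hw, fun n => ?_⟩
    simp only [iter_args hq0, hh, Bool.false_eq_true, if_false, one_mul]
    have hs := (summable_nat_add_iff n).2 (summable_gen_of_decay hM (y := |y|) (by rwa [abs_abs]))
    refine hs.congr fun j => ?_
    rw [add_comm j n, weight]
    push_cast
    ring

/-- Polylogarithms with all arguments but the last equal to `1` as generating functions of
`coeff 0 w`. -/
theorem converges_and_Li_eq_gen_short {w : List Bool} (hw : Admissible w) (hne : w ≠ [])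
    (hl : lead w = 0) {y : ℝ} (hy : |y| ≤ 1) {s : List ℕ} (hs : s.reverse = 1 :: exps w)
    (h : s.length = (shortArgs s.length y).length) :
    Converges s (shortArgs s.length y) h ∧
      Li s (shortArgs s.length y) h = gen (coeff 0 w) y := by
  have hz : ∀ l : List ℕ, List.zipWith weight l (List.replicate l.length 1)
      = l.map fun s => weight s 1 := fun l => by
    induction l with
    | nil => rfl
    | cons a l ih => simp [List.replicate_succ, ih]
  have hlen : s.length - 1 = (exps w).length := by
    rw [← List.length_reverse, hs]
    simp
  have hx : (shortArgs s.length y).reverse = y :: List.replicate (exps w).length 1 := by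
    simp [shortArgs, hlen]
  obtain ⟨M, hM⟩ := exists_decay_coeff (q := 0) (by simp) w hw hne
  have hc : ∀ n, iter ((exps w).map fun s => weight s 1) n = coeff 0 w n := fun n => by
    rw [coeff_zero_eq, hl, pow_zero, one_mul]
  have key := converges_and_Li_eq s (shortArgs s.length y) h ?_
  · refine ⟨key.1, key.2.trans ?_⟩
    rw [hs, hx, List.zipWith_cons_cons, hz, iter, gen]
    exact tsum_congr fun j => by rw [hc, weight_one_mul, zero_add]
  · rw [hs, hx, List.map_cons, List.map_replicate, abs_one, List.zipWith_cons_cons, hz]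
    refine ⟨iterSummable_exps w hw, fun n => ?_⟩
    simp only [hc]
    have hs := (summable_nat_add_iff n).2 (summable_gen_of_decay hM (y := |y|) (by rwa [abs_abs]))
    refine hs.congr fun j => ?_
    rw [add_comm j n, weight]
    push_cast
    ring

/-! ### The word attached to the blocks -/

/-- The word of a list of blocks `(m, u)`, everything in reversed order. -/
def blockWord : List (ℕ × ℕ) → List Bool
  | [] => []
  | b :: bs => List.replicate (b.2 + 1) true ++ (List.replicate (b.1 + 1) false ++ blockWord bs)

theorem blockWord_ne_nil : ∀ {bs : List (ℕ × ℕ)}, bs ≠ [] → blockWord bs ≠ []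
  | [], h => absurd rfl h
  | b :: bs, _ => by simp [blockWord, List.replicate_succ]

theorem headFalse_blockWord : ∀ bs, headFalse (blockWord bs) = false
  | [] => rfl
  | b :: bs => by simp [blockWord, List.replicate_succ, headFalse]

theorem lead_blockWord : ∀ bs, lead (blockWord bs) = 0
  | [] => rfl
  | b :: bs => by simp [blockWord, List.replicate_succ, lead]

theorem admissible_replicate_false {w : List Bool} (hw : Admissible w) :
    ∀ n, Admissible (List.replicate n false ++ w)
  | 0 => hw
  | n + 1 => admissible_replicate_false hw n

theorem admissible_replicate_true {w : List Bool} (hw : Admissible w) (hne : w ≠ []) :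
    ∀ n, Admissible (List.replicate n true ++ w)
  | 0 => hw
  | n + 1 => ⟨admissible_replicate_true hw hne n, by simp [hne]⟩

theorem admissible_blockWord : ∀ bs, Admissible (blockWord bs)
  | [] => trivial
  | _ :: bs => admissible_replicate_true (admissible_replicate_false (admissible_blockWord bs) _)
      (by simp [List.replicate_succ]) _

theorem args_replicate_false (q : ℝ) {w : List Bool} (hw : headFalse w = false) :
    ∀ n, args q (List.replicate (n + 1) false ++ w) = List.replicate n 1 ++ q :: args q w
  | 0 => by simp [args, hw]
  | n + 1 => by
    rw [List.replicate_succ, List.cons_append, args, args_replicate_false q hw n]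
    simp [List.replicate_succ, headFalse]

theorem args_replicate_true (q : ℝ) {w : List Bool} (hw : headFalse w = true) :
    ∀ n, args q (List.replicate (n + 1) true ++ w) = List.replicate n 1 ++ q⁻¹ :: args q w
  | 0 => by simp [args, hw]
  | n + 1 => by
    rw [List.replicate_succ, List.cons_append, args, args_replicate_true q hw n]
    simp [List.replicate_succ, headFalse]

theorem args_blockWord (q : ℝ) : ∀ bs : List (ℕ × ℕ), args q (blockWord bs)
    = (bs.map fun b =>
      ([q] ++ List.replicate b.1 1 ++ [1 / q] ++ List.replicate b.2 1).reverse).flatten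
  | [] => rfl
  | b :: bs => by
    rw [blockWord, args_replicate_true q (by simp [List.replicate_succ, headFalse]),
      args_replicate_false q (headFalse_blockWord bs), args_blockWord q bs]
    simp

theorem lead_replicate_false (w : List Bool) :
    ∀ n, lead (List.replicate n false ++ w) = n + lead w
  | 0 => by simp
  | n + 1 => by
    rw [List.replicate_succ, List.cons_append, lead, lead_replicate_false w n]
    omega

theorem exps_replicate_false (w : List Bool) :
    ∀ n, exps (List.replicate n false ++ w) = exps w
  | 0 => rfl
  | n + 1 => by
    rw [List.replicate_succ, List.cons_append, exps, exps_replicate_false w n]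

theorem exps_replicate_true (w : List Bool) :
    ∀ n, exps (List.replicate (n + 1) true ++ w) = List.replicate n 1 ++ (lead w + 1) :: exps w
  | 0 => by simp [exps]
  | n + 1 => by
    rw [List.replicate_succ, List.cons_append, exps, exps_replicate_true w n]
    simp [List.replicate_succ, lead]

theorem exps_blockWord : ∀ bs : List (ℕ × ℕ), exps (blockWord bs)
    = (bs.map fun b => ((b.1 + 2) :: List.replicate b.2 1).reverse).flatten
  | [] => rfl
  | b :: bs => by
    rw [blockWord, exps_replicate_true, exps_replicate_false, lead_replicate_false,
      lead_blockWord, exps_blockWord bs]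
    simp

/-- The blocks `(m_i, u_i - δ_{i,d})`. -/
def blocks {d : ℕ} (m u : Fin d → ℕ) : List (ℕ × ℕ) :=
  List.ofFn fun i => (m i, u i - deltaLast i)

theorem reverse_longArgs {d : ℕ} (m u : Fin d → ℕ) (p y : ℝ) :
    (longArgs m u p y).reverse = y :: args (1 - p) (blockWord (blocks m u).reverse) := by
  rw [args_blockWord, longArgs, List.reverse_append, List.reverse_flatten, blocks,
    List.map_reverse, List.map_ofFn, List.map_ofFn]
  rfl

theorem reverse_sString {d : ℕ} (m u : Fin d → ℕ) (hd : 1 ≤ d)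
    (hu : ∀ i : Fin d, (i : ℕ) + 1 = d → 1 ≤ u i) :
    (sString m u).reverse = 1 :: exps (blockWord (blocks m u).reverse) := by
  obtain ⟨e, rfl⟩ : ∃ e, d = e + 1 := ⟨d - 1, by omega⟩
  -- One 1 of the last block is the exponent of the outer series `gen` and not a letter of the word;
  -- hence the shift by `deltaLast` and the need for a positive last `u`.
  obtain ⟨v, hv⟩ : ∃ v, u (Fin.last e) = v + 1 :=
    ⟨_, (Nat.sub_add_cancel (hu (Fin.last e) (by simp))).symm⟩
  have h2 : ∀ i : Fin e, deltaLast i.castSucc = 0 := fun i => by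
    have := i.isLt
    simp only [deltaLast, Fin.val_castSucc]
    exact if_neg (by omega)
  have h3 : deltaLast (Fin.last e) = 1 := by simp [deltaLast]
  rw [exps_blockWord, sString, List.reverse_flatten, List.map_ofFn, blocks,
    reverse_ofFn_succ, reverse_ofFn_succ]
  simp [h2, h3, hv, List.replicate_succ, Function.comp_def]
  rw [List.append_cons, ← List.replicate_succ', List.replicate_succ, List.cons_append]

end StarPolylog

/-! ### Specialisation to a and to 1 - 1/p -/

theorem mainTheorem5 (d : ℕ) (hd : 1 ≤ d) (m u : Fin d → ℕ)
    (hu : ∀ i : Fin d, (i : ℕ) + 1 = d → 1 ≤ u i)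
    (a p : ℝ) (ha : a ∈ Set.Icc (-1 : ℝ) (1 / 3)) (hp : p ∈ Set.Icc (1 / 2 : ℝ) (3 / 2))
    (hp1 : p ≠ 1) (hap : |a| ≤ min 1 (2 / p - 1)) :
    let s : List ℕ := StarPolylog.sString m u
    let ones : List ℕ := List.replicate s.sum 1
    (StarPolylog.Converges ones (StarPolylog.longArgs m u p (1 - p))
        (StarPolylog.length_longArgs m u hd hu p (1 - p)) ∧
      StarPolylog.Converges ones (StarPolylog.longArgs m u p (1 - p + a * p))
        (StarPolylog.length_longArgs m u hd hu p (1 - p + a * p)) ∧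
      StarPolylog.Converges s (StarPolylog.shortArgs s.length a)
        (StarPolylog.length_shortArgs m u hd a) ∧
      StarPolylog.Converges s (StarPolylog.shortArgs s.length (1 - 1 / p))
        (StarPolylog.length_shortArgs m u hd (1 - 1 / p))) ∧
    StarPolylog.Li ones (StarPolylog.longArgs m u p (1 - p))
        (StarPolylog.length_longArgs m u hd hu p (1 - p))
      = - StarPolylog.Li s (StarPolylog.shortArgs s.length (1 - 1 / p))
          (StarPolylog.length_shortArgs m u hd (1 - 1 / p)) ∧
    StarPolylog.Li ones (StarPolylog.longArgs m u p (1 - p + a * p))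
        (StarPolylog.length_longArgs m u hd hu p (1 - p + a * p))
      = StarPolylog.Li s (StarPolylog.shortArgs s.length a)
          (StarPolylog.length_shortArgs m u hd a)
        - StarPolylog.Li s (StarPolylog.shortArgs s.length (1 - 1 / p))
          (StarPolylog.length_shortArgs m u hd (1 - 1 / p)) := by
  intro s ones
  obtain ⟨hp2, hp3⟩ := hp
  have hp0 : 0 < p := by linarith
  set w := StarPolylog.blockWord (StarPolylog.blocks m u).reverse with hw
  have hadm : StarPolylog.Admissible w := StarPolylog.admissible_blockWord _
  have hs : s.reverse = 1 :: StarPolylog.exps w := StarPolylog.reverse_sString m u hd hu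
  have hne : w ≠ [] := by
    apply StarPolylog.blockWord_ne_nil
    rw [StarPolylog.blocks, Ne, List.reverse_eq_nil_iff, List.ofFn_eq_nil_iff]
    omega
  -- The word starts with `true`, so neither a power of q nor a power of 1/(n+1) is left over.
  have hh := StarPolylog.headFalse_blockWord (StarPolylog.blocks m u).reverse
  have hl := StarPolylog.lead_blockWord (StarPolylog.blocks m u).reverse
  have hq0 : 1 - p ≠ 0 := sub_ne_zero.2 hp1.symm
  have hq1 : |1 - p| < 1 := abs_lt.2 ⟨by linarith, by linarith⟩
  have ha1 : |a| ≤ 1 := hap.trans (min_le_left _ _)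
  -- This bound is exactly what gives -1 ≤ 1 - p + a p.
  have hap2 : |a| * p ≤ 2 - p := by
    have h := mul_le_mul_of_nonneg_right (hap.trans (min_le_right _ _)) hp0.le
    rwa [sub_mul, div_mul_cancel₀ _ hp0.ne', one_mul] at h
  have hy : |1 - p + a * p| ≤ 1 := by
    have h1 := mul_le_mul_of_nonneg_right (neg_abs_le a) hp0.le
    have h2 := mul_le_mul_of_nonneg_right ha.2 hp0.le
    exact abs_le.2 ⟨by linarith, by linarith⟩
  have hr : |1 - 1 / p| ≤ 1 := by
    have h1 : 1 / p ≤ 2 := by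
      rw [div_le_iff₀ hp0]
      linarith
    have h2 : 0 ≤ 1 / p := by positivity
    exact abs_le.2 ⟨by linarith, by linarith⟩
  -- The point 1 - 1/p is the preimage of 0 under a ↦ q + p a.
  have hr0 : 1 - p + p * (1 - 1 / p) = 0 := by
    field_simp
    ring
  have L1 := StarPolylog.converges_and_Li_eq_gen_long hq0 hq1 hadm hne hh hq1.le
    (StarPolylog.reverse_longArgs m u p (1 - p)) (StarPolylog.length_longArgs m u hd hu p (1 - p))
  have L2 := StarPolylog.converges_and_Li_eq_gen_long hq0 hq1 hadm hne hh hy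
    (StarPolylog.reverse_longArgs m u p (1 - p + a * p))
    (StarPolylog.length_longArgs m u hd hu p (1 - p + a * p))
  have R1 := StarPolylog.converges_and_Li_eq_gen_short hadm hne hl ha1 hs
    (StarPolylog.length_shortArgs m u hd a)
  have R2 := StarPolylog.converges_and_Li_eq_gen_short hadm hne hl hr hs
    (StarPolylog.length_shortArgs m u hd (1 - 1 / p))
  have key := StarPolylog.gen_coeff_affine hp0 rfl hq1 w hadm
  have k1 := key a ha1 (by rwa [mul_comm p a]) fun h => absurd h hne
  have k2 := key (1 - 1 / p) hr (by rw [hr0]; simp) fun h => absurd h hne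
  rw [hr0, StarPolylog.gen_zero] at k2
  rw [mul_comm p a] at k1
  refine ⟨⟨L1.1, L2.1, R1.1, R2.1⟩, ?_, ?_⟩
  · refine L1.2.trans ?_
    rw [R2.2]
    linarith
  · refine L2.2.trans ?_
    rw [R1.2, R2.2, k1]
    linarith
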